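/- Let $d\ge 1$. Slicing schedules. Start from the single cell $\Omega_0=\mathbb{R}^d$ (with address $0$). At step $k=1,2,\dots$ one chooses the address $b_k$ of a cell present at that moment and a unit vector $s_k\in\mathbb{S}^{d-1}$, and replaces $\Omega_{b_k}$ by the two cells $\Omega_{b_k0}=\Omega_{b_k}\cap\{x\cdot s_k\le h_k\}$ and $\Omega_{b_k1}=\Omega_{b_k}\cap\{x\cdot s_k>h_k\}$. The sequence $\mathcal{S}=((b_k,s_k))_{k\ge1}$ is called a slicing schedule. For an absolutely continuous probability measure $\mu$ the heights $h_k=h_k^\mu$ are chosen so that $\mu(x\cdot s_k\le h_k\mid\Omega^\mu_{b_k})=\mu(x\cdot s_k>h_k\mid\Omega^\mu_{b_k})=\tfrac12$; if such a height is not unique, any choice is allowed. The schedule is admissible if there is a basis $\{e_1,\dots,e_d\}$ of $\mathbb{R}^d$ with $s_k\in\{e_1,\dots,e_d\}$ for all $k$ and every cell is partitioned in each of the directions $e_j$ infinitely many times, i.e. for every infinite sequence of digits $i_1,i_2,\dots\in\{0,1\}$ and every $j$, infinitely many of the cells with addresses $0,\ 0i_1,\ 0i_1i_2,\dots$ are cut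 in the direction $e_j$. Let $\ell^\mu_k(x)=\sum_{\alpha=0}^m i_\alpha 3^{-\alpha}$ if $i_0i_1\cdots i_m$ is the address of the cell containing $x$ after $k$ cuts, and $\ell^\mu=\lim_{k\to\infty}\ell^\mu_k$. The no-collision map $t_\mu^\nu$ sends $x$ to the unique point $y$ of the interior of $\mathrm{supp}(\nu)$ with $\ell^\nu(y)=\ell^\mu(x)$, and for $p\ge 1$ we set $$W_{\mathcal{S},p}(\mu,\nu)=\Big(\int_{\mathbb{R}^d}|t_\mu^\nu(x)-x|^p\,d\mu(x)\Big)^{1/p},\qquad W_p(\mu,\nu)=\Big(\min_{T\sharp\mu=\nu}\int_{\mathbb{R}^d}|x-T(x)|^p\,d\mu(x)\Big)^{1/p},$$ the minimum being over Borel maps $T:\mathbb{R}^d\to\mathbb{R}^d$. Let $\mathcal{K}$ be the class of compactly supported probability measures $d\mu=f(x)\,dx$ on $\mathbb{R}^d$ with $\mu(\partial\,\mathrm{supp}(\mu))=0$ and $c_\mu\le f\le C_\mu$ $\mu$-a.e. for some constants $c_\mu,C_\mu>0$. Theorem. Let $\mu_0\in\mathcal{K}$, let $\mu_\theta=(x+\theta)\sharp\mu_0$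 for $\theta\in\mathbb{R}^d$, let $\mathcal{S}$ be an admissible slicing schedule, and let $p\in[1,\infty)$. Then for all $\theta,\theta'\in\mathbb{R}^d$ the no-collision map from $\mu_\theta$ to $\mu_{\theta'}$ is defined $\mu_\theta$-a.e., on the interior of $\mathrm{supp}(\mu_\theta)$, is $\mu_\theta$-measurable and pushes $\mu_\theta$ forward to $\mu_{\theta'}$, the minimum defining $W_p(\mu_\theta,\mu_{\theta'})$ is attained, and $$W_{\mathcal{S},p}(\mu_\theta,\mu_{\theta'})=W_p(\mu_\theta,\mu_{\theta'})=|\theta-\theta'|.$$ Moreover, for every $\Theta\subset\mathbb{R}^d$, $W_{\mathcal{S},p}$ is a metric on $\{\mu_\theta:\theta\in\Theta\}$, and $\theta\mapsto\mu_\theta$ is an isometry of $(\Theta,|\cdot|)$ onto $(\{\mu_\theta:\theta\in\Theta\},W_{\mathcal{S},p})$. -/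

import Mathlib

open MeasureTheory Filter Topology
open scoped ENNReal

noncomputable section

namespace NoCollision

/-- The Euclidean space `ℝ^d`. -/
abbrev Space (d : ℕ) : Type := EuclideanSpace ℝ (Fin d)

/-! ### Slicing schedules -/

/-- The addresses of the cells present after the first `k` cuts, when the `j`-th cut
splits the cell with address `addr j` into the cells `addr j 0` and `addr j 1`.
The initial cell (the whole space) has the address `0`; the digits are Booleans. -/
def leaves (addr : ℕ → List Bool) : ℕ → Set (List Bool)
  | 0 => {[false]}
  | k + 1 => (leaves addr k \ {addr k}) ∪ {addr k ++ [false], addr k ++ [true]}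

/-- A slicing schedule in `ℝ^d`: at each step (steps are counted from `0`) the address of a cell
that is present at that step, and a unit vector, the direction in which this cell is cut. -/
structure Schedule (d : ℕ) where
  addr : ℕ → List Bool
  dir : ℕ → Space d
  addr_mem : ∀ k, addr k ∈ leaves addr k
  norm_dir : ∀ k, ‖dir k‖ = 1

/-- The address `0 i₁ ⋯ iₘ` formed by the first `m` digits of an infinite sequence of digits. -/
def branch (i : ℕ → Bool) (m : ℕ) : List Bool := false :: (List.range m).map i

/-- The admissible schedules: all directions belong to a basis `e` of `ℝ^d`, and along every
infinite nested sequence of addresses, cuts in each of the directions `e j` occur infinitely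
often. -/
def Schedule.Admissible {d : ℕ} (S : Schedule d) : Prop :=
  ∃ e : Module.Basis (Fin d) ℝ (Space d),
    (∀ k, S.dir k ∈ Set.range e) ∧
    ∀ (i : ℕ → Bool) (j : Fin d), {k | (∃ m, S.addr k = branch i m) ∧ S.dir k = e j}.Infinite

/-! ### Slicing a measure -/

/-- The address of the cell containing `x` after `k` cuts, the `k`-th cut being made at height
`h k`: the points `x` of the cell being cut with `x ⬝ s ≤ h` receive the new digit `0`, those with
`x ⬝ s > h` the new digit `1`, and the points outside of that cell keep their address. -/
def Schedule.address {d : ℕ} (S : Schedule d) (h : ℕ → ℝ) : ℕ → Space d → List Bool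
  | 0, _ => [false]
  | k + 1, x =>
    if S.address h k x = S.addr k then S.addr k ++ [decide (h k < inner ℝ x (S.dir k))]
    else S.address h k x

/-- The cell `Ω_b` of the partition of `ℝ^d` obtained after `k` cuts. -/
def Schedule.cell {d : ℕ} (S : Schedule d) (h : ℕ → ℝ) (k : ℕ) (b : List Bool) :
    Set (Space d) := {x | S.address h k x = b}

/-- The heights `h` are such that each cut halves the conditional measure of the cell being cut. -/
def Schedule.IsMedian {d : ℕ} (S : Schedule d) (μ : Measure (Space d)) (h : ℕ → ℝ) : Prop :=
  ∀ k, ProbabilityTheory.cond μ (S.cell h k (S.addr k)) {x | inner ℝ x (S.dir k) ≤ h k} = 1 / 2 ∧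
    ProbabilityTheory.cond μ (S.cell h k (S.addr k)) {x | h k < inner ℝ x (S.dir k)} = 1 / 2

/-- A slicing of all absolutely continuous probability measures according to the schedule `S`.
The heights of the cuts need not be unique; the structure records a choice for every measure. -/
structure Slicing {d : ℕ} (S : Schedule d) where
  height : Measure (Space d) → ℕ → ℝ
  isMedian : ∀ μ : Measure (Space d), IsProbabilityMeasure μ → μ ≪ volume → S.IsMedian μ (height μ)

/-! Slicings exist: absolute continuity provides the heights step by step. -/

/-- The addresses after a cut at height `t`, given the addresses before the cut. -/
def Schedule.next {d : ℕ} (S : Schedule d) (k : ℕ) (t : ℝ) (L : Space d → List Bool)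
    (x : Space d) : List Bool :=
  if L x = S.addr k then S.addr k ++ [decide (t < inner ℝ x (S.dir k))] else L x

theorem exists_median {d : ℕ} (μ : Measure (Space d)) [IsProbabilityMeasure μ]
    (hμ : μ ≪ volume) (s : Space d) (hs : ‖s‖ = 1) :
    ∃ t : ℝ, μ {x | inner ℝ x s ≤ t} = 1 / 2 ∧ μ {x | t < inner ℝ x s} = 1 / 2 := by
  have hm : Measurable fun x : Space d => (inner ℝ x s : ℝ) := by fun_prop
  set ρ : Measure ℝ := μ.map fun x : Space d => (inner ℝ x s : ℝ) with hρ
  have : IsProbabilityMeasure ρ := Measure.isProbabilityMeasure_map hm.aemeasurable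
  have hs0 : s ≠ 0 := by
    rintro rfl
    simp at hs
  have hatom : ∀ a, ρ {a} = 0 := by
    intro a
    rw [hρ, Measure.map_apply hm (measurableSet_singleton a)]
    refine hμ ?_
    have hsub : (fun x : Space d => (inner ℝ x s : ℝ)) ⁻¹' {a} =
        (fun x => x + (-(a • s))) ⁻¹' ((ℝ ∙ s)ᗮ : Submodule ℝ (Space d)) := by
      ext x
      simp only [Set.mem_preimage, Set.mem_singleton_iff, SetLike.mem_coe,
        Submodule.mem_orthogonal_singleton_iff_inner_left]
      rw [inner_add_left, inner_neg_left, real_inner_smul_left, real_inner_self_eq_norm_sq, hs]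
      constructor <;> intro h <;> linarith
    rw [hsub, measure_preimage_add_right]
    refine Measure.addHaar_submodule _ _ fun htop => hs0 ?_
    have : s ∈ (ℝ ∙ s)ᗮ := htop ▸ Submodule.mem_top
    exact inner_self_eq_zero.1 (Submodule.mem_orthogonal_singleton_iff_inner_left.1 this)
  have hcont : Continuous (ProbabilityTheory.cdf ρ) := by
    refine continuous_iff_continuousAt.2 fun a => ?_
    rw [(ProbabilityTheory.monotone_cdf ρ).continuousAt_iff_leftLim_eq_rightLim,
      StieltjesFunction.rightLim_eq]
    have h1 := (ProbabilityTheory.cdf ρ).measure_singleton a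
    rw [ProbabilityTheory.measure_cdf, hatom a, eq_comm, ENNReal.ofReal_eq_zero] at h1
    exact le_antisymm ((ProbabilityTheory.monotone_cdf ρ).leftLim_le le_rfl) (by linarith)
  obtain ⟨t, ht⟩ : (1 / 2 : ℝ) ∈ Set.range (ProbabilityTheory.cdf ρ) :=
    mem_range_of_exists_le_of_exists_ge hcont
      (((ProbabilityTheory.tendsto_cdf_atBot ρ).eventually_le_const (by norm_num)).exists)
      (((ProbabilityTheory.tendsto_cdf_atTop ρ).eventually_const_le (by norm_num)).exists)
  have hle : μ {x | inner ℝ x s ≤ t} = 1 / 2 := by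
    have h1 := ProbabilityTheory.ofReal_cdf ρ t
    rw [ht, hρ, Measure.map_apply hm measurableSet_Iic] at h1
    change μ ((fun x : Space d => (inner ℝ x s : ℝ)) ⁻¹' Set.Iic t) = 1 / 2
    rw [← h1, ENNReal.ofReal_div_of_pos (by norm_num)]
    simp
  refine ⟨t, hle, ?_⟩
  have hc : {x : Space d | t < inner ℝ x s} = {x | inner ℝ x s ≤ t}ᶜ := by
    ext x
    simp
  rw [hc, prob_compl_eq_one_sub (measurableSet_le hm measurable_const), hle]
  simp

theorem Schedule.measurable_next {d : ℕ} (S : Schedule d) (k : ℕ) (t : ℝ)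
    {L : Space d → List Bool} (hL : ∀ b, MeasurableSet {x | L x = b}) (b : List Bool) :
    MeasurableSet {x | S.next k t L x = b} := by
  have hm : Measurable fun x : Space d => (inner ℝ x (S.dir k) : ℝ) := by fun_prop
  have h1 : MeasurableSet {x | t < inner ℝ x (S.dir k)} := measurableSet_lt measurable_const hm
  have h2 : ∀ c : Prop, MeasurableSet {x : Space d | c} := fun c => MeasurableSet.const c
  have : {x | S.next k t L x = b} =
      ({x | L x = S.addr k} ∩ (({x | t < inner ℝ x (S.dir k)} ∩ {x | S.addr k ++ [true] = b}) ∪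
        ({x | t < inner ℝ x (S.dir k)}ᶜ ∩ {x | S.addr k ++ [false] = b}))) ∪
      ({x | L x = S.addr k}ᶜ ∩ {x | L x = b}) := by
    ext x
    by_cases hx : L x = S.addr k <;> by_cases hy : t < inner ℝ x (S.dir k) <;>
      simp [Schedule.next, hx, hy]
  rw [this]
  exact ((hL _).inter ((h1.inter (h2 _)).union (h1.compl.inter (h2 _)))).union
    ((hL _).compl.inter (hL b))

open Classical in
/-- A median height for the `k`-th cut, given the addresses before the cut. -/
def Schedule.medianHeight {d : ℕ} (S : Schedule d) (μ : Measure (Space d)) (k : ℕ)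
    (L : Space d → List Bool) : ℝ :=
  if h : ∃ t : ℝ, ProbabilityTheory.cond μ {x | L x = S.addr k} {x | inner ℝ x (S.dir k) ≤ t} = 1 / 2 ∧
    ProbabilityTheory.cond μ {x | L x = S.addr k} {x | t < inner ℝ x (S.dir k)} = 1 / 2
  then h.choose else 0

/-- The addresses that result from cutting at the median heights. -/
def Schedule.medianAddress {d : ℕ} (S : Schedule d) (μ : Measure (Space d)) :
    ℕ → Space d → List Bool
  | 0 => fun _ => [false]
  | k + 1 => S.next k (S.medianHeight μ k (S.medianAddress μ k)) (S.medianAddress μ k)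

theorem Schedule.exists_isMedian {d : ℕ} (S : Schedule d) (μ : Measure (Space d))
    [IsProbabilityMeasure μ] (hμ : μ ≪ volume) : ∃ h, S.IsMedian μ h := by
  set L := S.medianAddress μ with hL
  set h : ℕ → ℝ := fun k => S.medianHeight μ k (L k) with hh
  have hadd : ∀ k, S.address h k = L k := by
    intro k
    induction k with
    | zero => rfl
    | succ k ih =>
      funext x
      rw [Schedule.address, ih]
      rfl
  have hmeas : ∀ k b, MeasurableSet {x | L k x = b} := by
    intro k
    induction k with
    | zero => exact fun b => MeasurableSet.const ([false] = b)
    | succ k ih => exact fun b => S.measurable_next k _ ih b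
  have hmed : ∀ k, μ {x | L k x = S.addr k} ≠ 0 →
      ProbabilityTheory.cond μ {x | L k x = S.addr k} {x | inner ℝ x (S.dir k) ≤ h k} = 1 / 2 ∧
      ProbabilityTheory.cond μ {x | L k x = S.addr k} {x | h k < inner ℝ x (S.dir k)} = 1 / 2 := by
    intro k hk
    have := ProbabilityTheory.cond_isProbabilityMeasure hk
    have hex := exists_median (ProbabilityTheory.cond μ {x | L k x = S.addr k})
      (ProbabilityTheory.cond_absolutelyContinuous.trans hμ) (S.dir k) (S.norm_dir k)
    have heq : h k = hex.choose := dif_pos hex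
    rw [heq]
    exact hex.choose_spec
  have hpos : ∀ k, ∀ b ∈ leaves S.addr k, μ {x | L k x = b} ≠ 0 := by
    intro k
    induction k with
    | zero =>
      rintro b rfl
      have : {x | L 0 x = [false]} = Set.univ := Set.eq_univ_of_forall fun x => rfl
      rw [this, measure_univ]
      exact one_ne_zero
    | succ k ih =>
      have hk := hmed k (ih _ (S.addr_mem k))
      have hhalf : ∀ A : Set (Space d), ProbabilityTheory.cond μ {x | L k x = S.addr k} A = 1 / 2 →
          μ ({x | L k x = S.addr k} ∩ A) ≠ 0 := by
        intro A hA h0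
        rw [ProbabilityTheory.cond_apply (hmeas k _), h0, mul_zero] at hA
        exact ENNReal.inv_ne_zero.2 ENNReal.ofNat_ne_top ((one_div _).symm.trans hA.symm)
      rintro b (⟨hb, hne⟩ | rfl | rfl)
      · refine fun h0 => ih b hb (measure_mono_null (fun x hx => ?_) h0)
        have hx' : L k x = b := hx
        have : L k x ≠ S.addr k := fun e => hne (hx'.symm.trans e)
        exact (if_neg this).trans hx'
      · refine fun h0 => hhalf _ hk.1 (measure_mono_null (fun x hx => ?_) h0)
        have h2 : ¬ h k < inner ℝ x (S.dir k) := not_lt.2 hx.2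
        refine (if_pos hx.1).trans ?_
        rw [decide_eq_false h2]
      · refine fun h0 => hhalf _ hk.2 (measure_mono_null (fun x hx => ?_) h0)
        have h2 : h k < inner ℝ x (S.dir k) := hx.2
        refine (if_pos hx.1).trans ?_
        rw [decide_eq_true h2]
  refine ⟨h, fun k => ?_⟩
  have : S.cell h k (S.addr k) = {x | L k x = S.addr k} := by
    unfold Schedule.cell
    rw [hadd]
  rw [this]
  exact hmed k (hpos k _ (S.addr_mem k))

open Classical in
instance {d : ℕ} (S : Schedule d) : Nonempty (Slicing S) :=
  ⟨{ height := fun μ => if h : ∃ h, S.IsMedian μ h then h.choose else 0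
     isMedian := fun μ _ hac => by
      have hex := S.exists_isMedian μ hac
      rw [dif_pos hex]
      exact hex.choose_spec }⟩

/-- The number `∑ i_α / 3^α` of an address `i_0 i_1 ⋯ i_m`. -/
def code (b : List Bool) : ℝ := ∑ α ∈ Finset.range b.length, (if b.getD α false then 1 else 0) / 3 ^ α

/-- The function `ℓ_k`. -/
def Schedule.levelAt {d : ℕ} (S : Schedule d) (h : ℕ → ℝ) (k : ℕ) (x : Space d) : ℝ :=
  code (S.address h k x)

theorem code_append (b : List Bool) (i : Bool) :
    code (b ++ [i]) = code b + (if i then 1 else 0) / 3 ^ b.length := by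
  unfold code
  rw [List.length_append, List.length_singleton, Finset.sum_range_succ]
  congr 1
  · refine Finset.sum_congr rfl fun α hα => ?_
    rw [List.getD_append _ _ _ _ (Finset.mem_range.1 hα)]
  · simp

theorem code_le (b : List Bool) : code b ≤ 3 / 2 := by
  have hs : HasSum (fun n : ℕ => (1 / 3 : ℝ) ^ n) (1 - 1 / 3)⁻¹ :=
    hasSum_geometric_of_lt_one (by norm_num) (by norm_num)
  have h1 : ∑ n ∈ Finset.range b.length, (1 / 3 : ℝ) ^ n ≤ (1 - 1 / 3)⁻¹ :=
    sum_le_hasSum _ (fun n _ => by positivity) hs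
  have h2 : code b ≤ ∑ n ∈ Finset.range b.length, (1 / 3 : ℝ) ^ n := by
    refine Finset.sum_le_sum fun n _ => ?_
    rw [one_div_pow]
    gcongr
    split_ifs <;> norm_num
  refine (h2.trans h1).trans (by norm_num)

theorem Schedule.monotone_levelAt {d : ℕ} (S : Schedule d) (h : ℕ → ℝ) (x : Space d) :
    Monotone fun k => S.levelAt h k x := by
  refine monotone_nat_of_le_succ fun k => ?_
  unfold Schedule.levelAt
  rw [Schedule.address]
  split_ifs with hk
  · rw [hk, code_append]
    refine le_add_of_nonneg_right (div_nonneg ?_ (by positivity))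
    split_ifs <;> norm_num
  · exact le_rfl

/-- The function `ℓ = lim ℓ_k` (the limit exists, see `Schedule.tendsto_levelAt`). -/
def Schedule.level {d : ℕ} (S : Schedule d) (h : ℕ → ℝ) (x : Space d) : ℝ :=
  limUnder atTop fun k => S.levelAt h k x

theorem Schedule.tendsto_levelAt {d : ℕ} (S : Schedule d) (h : ℕ → ℝ) (x : Space d) :
    Tendsto (fun k => S.levelAt h k x) atTop (𝓝 (S.level h x)) := by
  refine tendsto_nhds_limUnder ⟨_, tendsto_atTop_ciSup (S.monotone_levelAt h x) ⟨3 / 2, ?_⟩⟩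
  rintro _ ⟨k, rfl⟩
  exact code_le _

/-! ### The class of measures, no-collision maps and distances -/

/-- The class `𝒦`: compactly supported probability measures `dμ = f dx` with
`μ(∂ supp μ) = 0` and `c ≤ f ≤ C` `μ`-almost everywhere for some constants `c, C > 0`. -/
structure ClassK {d : ℕ} (μ : Measure (Space d)) : Prop where
  isProbabilityMeasure : IsProbabilityMeasure μ
  isCompact_support : IsCompact μ.support
  frontier_support : μ (frontier μ.support) = 0
  density : ∃ (f : Space d → ℝ) (c C : ℝ), Measurable f ∧ (∀ x, 0 ≤ f x) ∧
    μ = volume.withDensity (fun x => ENNReal.ofReal (f x)) ∧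
    0 < c ∧ 0 < C ∧ ∀ᵐ x ∂μ, c ≤ f x ∧ f x ≤ C

/-- `y` corresponds to `x`: it lies in the interior of the support of `ν` and
`ℓ^ν(y) = ℓ^μ(x)`. -/
def Slicing.Matches {d : ℕ} {S : Schedule d} (H : Slicing S) (μ ν : Measure (Space d))
    (x y : Space d) : Prop :=
  y ∈ interior ν.support ∧ S.level (H.height ν) y = S.level (H.height μ) x

open Classical in
/-- The no-collision map `t_μ^ν(x) = (ℓ^ν)⁻¹(ℓ^μ(x))`: the unique point `y` of the interior of the
support of `ν` with `ℓ^ν(y) = ℓ^μ(x)`. Where there is no such unique point the value is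
arbitrary. -/
def Slicing.map {d : ℕ} {S : Schedule d} (H : Slicing S) (μ ν : Measure (Space d))
    (x : Space d) : Space d :=
  if h : ∃! y, H.Matches μ ν x y then h.choose else 0

/-- The no-collision map is well defined `μ`-almost everywhere, on the interior of the support
of `μ`, it is (`μ`-a.e. equal to) a measurable map, and it transports `μ` into `ν`. -/
def Slicing.MapWellDefined {d : ℕ} {S : Schedule d} (H : Slicing S)
    (μ ν : Measure (Space d)) : Prop :=
  (∀ᵐ x ∂μ, x ∈ interior μ.support ∧ ∃! y, H.Matches μ ν x y) ∧
    AEMeasurable (H.map μ ν) μ ∧ μ.map (H.map μ ν) = ν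

/-- The transportation cost `∫ |T(x) - x|^p dμ(x)`. -/
def cost {d : ℕ} (p : ℝ) (μ : Measure (Space d)) (T : Space d → Space d) : ℝ≥0∞ :=
  ∫⁻ x, ‖T x - x‖ₑ ^ p ∂μ

/-- The no-collision distance `W_{𝒮,p}(μ,ν) = (∫ |t_μ^ν(x) - x|^p dμ(x))^{1/p}`. -/
def Slicing.dist {d : ℕ} {S : Schedule d} (H : Slicing S) (p : ℝ)
    (μ ν : Measure (Space d)) : ℝ≥0∞ :=
  cost p μ (H.map μ ν) ^ (1 / p)

/-- The costs of all Borel maps that transport `μ` into `ν`. -/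
def transportCosts {d : ℕ} (p : ℝ) (μ ν : Measure (Space d)) : Set ℝ≥0∞ :=
  {c | ∃ T : Space d → Space d, Measurable T ∧ μ.map T = ν ∧ c = cost p μ T}

/-- The optimal transportation distance `W_p`. -/
def wasserstein {d : ℕ} (p : ℝ) (μ ν : Measure (Space d)) : ℝ≥0∞ :=
  sInf (transportCosts p μ ν) ^ (1 / p)

/-- The translate `μ_θ = (x + θ)♯μ₀`. -/
def translate {d : ℕ} (μ₀ : Measure (Space d)) (θ : Space d) : Measure (Space d) :=
  μ₀.map (fun x => x + θ)

end NoCollision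

end

/-!
The translation `x ↦ x + (θ' - θ)` carries `μ_θ` to `μ_θ'`, and it is optimal: by Jensen's
inequality every transport map costs at least `|θ' - θ| ^ p`, the barycenters of the two measures
being at that distance (`le_cost_translate`). So everything follows once the no-collision map is
known to be almost everywhere equal to this translation (`Slicing.map_translate_ae_eq`). Cuts of
`μ_θ` at the heights `h k` are cuts of `μ₀` at the heights `h k - ⟪θ, s k⟫`, and both are halvings;
hence two facts about a single measure are needed.

* The addresses of almost every point do not depend on the choice of the median heights
  (`Schedule.IsMedian.ae_address_eq`), because the slab between two medians is null. Therefore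
  the translated point has the same level.
* Almost every point is determined by its level. The level determines all addresses
  (`Schedule.address_eq_of_level_eq`), since a digit outweighs all later ones in base `3`.
  Suppose that `y` shares all its addresses with another point of the support of `μ₀`, whose
  coordinate in a direction `e j` differs from that of `y` by `δ > 0`. Infinitely many cuts of the
  cells around `y` have the direction `e j`. Their heights are bounded, so two of them are within
  `δ / N` of each other, and the second one discards half of the mass of its cell in a slab of
  width `δ / N`, while the cell is a box of width at least `δ`. As the density of `μ₀` is bounded
  above, the mass of the cell is at most `O(1 / N)` times the volume of its bounded part
  (`Schedule.IsMedian.exists_sparse_cell`). Cells being nested or disjoint, the maximal ones among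
  these sparse cells are a disjoint cover of all such points `y`
  (`Schedule.measure_le_of_cover`), which therefore have total mass `O(1 / N)` for every `N`.

Injectivity of the level is proved only almost everywhere: the support of `μ₀` may be much larger
than the set where the density is positive, so the density has no lower bound near a point of the
interior of the support.
-/

namespace NoCollision

variable {d : ℕ} {S : Schedule d} {h : ℕ → ℝ} {x y : Space d} {k : ℕ}

/-! ### Addresses -/


theorem Schedule.address_succ_of_eq (hx : S.address h k x = S.addr k) :
    S.address h (k + 1) x = S.addr k ++ [decide (h k < inner ℝ x (S.dir k))] := by
  rw [Schedule.address, if_pos hx]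

theorem Schedule.address_succ_of_ne (hx : S.address h k x ≠ S.addr k) :
    S.address h (k + 1) x = S.address h k x := by
  rw [Schedule.address, if_neg hx]

theorem Schedule.address_succ_eq_iff (hx : S.address h k x = S.addr k)
    (hy : S.address h k y = S.addr k) :
    S.address h (k + 1) x = S.address h (k + 1) y ↔
      (h k < inner ℝ x (S.dir k) ↔ h k < inner ℝ y (S.dir k)) := by
  rw [address_succ_of_eq hx, address_succ_of_eq hy]
  simp

theorem Schedule.address_prefix {k n : ℕ} (hkn : k ≤ n) :
    S.address h k x <+: S.address h n x := by
  induction n, hkn using Nat.le_induction with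
  | base => exact List.prefix_rfl
  | succ n _ ih =>
    refine ih.trans ?_
    by_cases hx : S.address h n x = S.addr n
    · rw [address_succ_of_eq hx, hx]
      exact List.prefix_append _ _
    · rw [address_succ_of_ne hx]

/-- No later digits can push the code of a point beyond this upper bound: from position `n` on,
all digits together contribute at most `∑ α ≥ n, 3 ^ (-α) = (3 / 2) / 3 ^ n`. -/
theorem Schedule.antitone_levelAt_add (S : Schedule d) (h : ℕ → ℝ) (x : Space d) :
    Antitone fun k => S.levelAt h k x + 3 / 2 / 3 ^ (S.address h k x).length := by
  refine antitone_nat_of_succ_le fun k => ?_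
  unfold Schedule.levelAt
  by_cases hx : S.address h k x = S.addr k
  · rw [address_succ_of_eq hx, hx, code_append, List.length_append, List.length_singleton, pow_succ]
    have : (0 : ℝ) < 1 / 3 ^ (S.addr k).length := by positivity
    have h1 : (if decide (h k < inner ℝ x (S.dir k)) = true then (1 : ℝ) else 0) /
        3 ^ (S.addr k).length ≤ 1 / 3 ^ (S.addr k).length := by
      gcongr
      split_ifs <;> norm_num
    have h2 : (3 / 2 : ℝ) / (3 ^ (S.addr k).length * 3) = 1 / 2 * (1 / 3 ^ (S.addr k).length) := by
      field_simp
    have h3 : (3 / 2 : ℝ) / 3 ^ (S.addr k).length = 3 / 2 * (1 / 3 ^ (S.addr k).length) := by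
      field_simp
    rw [h2, h3]
    linarith
  · rw [address_succ_of_ne hx]

/-- The gap between the codes of two points that are separated by the cut `k`: the digit `1`
outweighs all later digits. -/
theorem Schedule.levelAt_gap_of_cut (hx : S.address h k x = S.addr k)
    (hy : S.address h k y = S.addr k) (hxk : ¬ h k < inner ℝ x (S.dir k))
    (hyk : h k < inner ℝ y (S.dir k)) {n : ℕ} (hn : k + 1 ≤ n) :
    S.levelAt h n x + 1 / 2 / 3 ^ (S.addr k).length ≤ S.levelAt h n y := by
  have h1 := S.antitone_levelAt_add h x hn
  have h2 := S.monotone_levelAt h y hn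
  have h3 : S.levelAt h (k + 1) y = code (S.addr k) + 1 / 3 ^ (S.addr k).length := by
    rw [levelAt, address_succ_of_eq hy, code_append]
    simp [hyk]
  have h4 : S.levelAt h (k + 1) x = code (S.addr k) := by
    rw [levelAt, address_succ_of_eq hx, code_append]
    simp [not_lt.1 hxk]
  have h5 : (S.address h (k + 1) x).length = (S.addr k).length + 1 := by
    rw [address_succ_of_eq hx]
    simp
  simp only [h3, h4, h5, pow_succ] at h1 h2
  have h6 : (3 / 2 : ℝ) / (3 ^ (S.addr k).length * 3) = 1 / 2 * (1 / 3 ^ (S.addr k).length) := by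
    field_simp
  have h7 : (1 / 2 : ℝ) / 3 ^ (S.addr k).length = 1 / 2 * (1 / 3 ^ (S.addr k).length) := by
    field_simp
  have h8 : (0 : ℝ) < 3 / 2 / 3 ^ (S.address h n x).length := by positivity
  rw [h6] at h1
  rw [h7]
  linarith

theorem Schedule.levelAt_gap (hxy : S.address h k x ≠ S.address h k y) :
    ∃ ε > 0, (∀ n ≥ k, S.levelAt h n x + ε ≤ S.levelAt h n y) ∨
      (∀ n ≥ k, S.levelAt h n y + ε ≤ S.levelAt h n x) := by
  induction k with
  | zero => exact absurd rfl hxy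
  | succ k ih =>
    by_cases he : S.address h k x = S.address h k y
    · by_cases hy : S.address h k y = S.addr k
      · have hx := he.trans hy
        refine ⟨1 / 2 / 3 ^ (S.addr k).length, by positivity, ?_⟩
        by_cases hxk : h k < inner ℝ x (S.dir k) <;> by_cases hyk : h k < inner ℝ y (S.dir k)
        · exact absurd ((address_succ_eq_iff hx hy).2 (by simp [hxk, hyk])) hxy
        · exact .inr fun n hn => levelAt_gap_of_cut hy hx hyk hxk hn
        · exact .inl fun n hn => levelAt_gap_of_cut hx hy hxk hyk hn
        · exact absurd ((address_succ_eq_iff hx hy).2 (by simp [hxk, hyk])) hxy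
      · rw [address_succ_of_ne hy, address_succ_of_ne (he ▸ hy)] at hxy
        exact absurd he hxy
    · obtain ⟨ε, hε, H⟩ := ih he
      exact ⟨ε, hε, H.imp (fun H n hn => H n (by omega)) (fun H n hn => H n (by omega))⟩

theorem Schedule.address_eq_of_le {k n : ℕ} (hkn : k ≤ n)
    (hxy : S.address h n x = S.address h n y) : S.address h k x = S.address h k y := by
  by_contra hne
  have he : S.levelAt h n x = S.levelAt h n y := by rw [levelAt, levelAt, hxy]
  obtain ⟨ε, hε, H | H⟩ := levelAt_gap hne <;> linarith [H n hkn]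

theorem Schedule.address_eq_of_level_eq (hxy : S.level h x = S.level h y) (k : ℕ) :
    S.address h k x = S.address h k y := by
  by_contra hne
  have hx := S.tendsto_levelAt h x
  have hy := S.tendsto_levelAt h y
  obtain ⟨ε, hε, H | H⟩ := levelAt_gap hne
  · have := le_of_tendsto_of_tendsto (hx.add_const ε) hy (eventually_atTop.2 ⟨k, H⟩)
    linarith
  · have := le_of_tendsto_of_tendsto (hy.add_const ε) hx (eventually_atTop.2 ⟨k, H⟩)
    linarith

theorem Schedule.address_mem_leaves (S : Schedule d) (h : ℕ → ℝ) (k : ℕ) (x : Space d) :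
    S.address h k x ∈ leaves S.addr k := by
  induction k with
  | zero => rfl
  | succ k ih =>
    by_cases hx : S.address h k x = S.addr k
    · rw [address_succ_of_eq hx]
      right
      cases decide (h k < inner ℝ x (S.dir k)) <;> simp
    · rw [address_succ_of_ne hx]
      exact .inl ⟨ih, hx⟩

/-- The addresses present at any time form a prefix code. -/
theorem Schedule.leaves_prefix_free (S : Schedule d) (k : ℕ) :
    ∀ b ∈ leaves S.addr k, ∀ b' ∈ leaves S.addr k, b <+: b' → b = b' := by
  induction k with
  | zero =>
    rintro _ rfl _ rfl _
    rfl
  | succ k ih =>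
    have ha := S.addr_mem k
    have key : ∀ b, b ∈ leaves S.addr (k + 1) →
        (b ∈ leaves S.addr k ∧ b ≠ S.addr k) ∨ ∃ i, b = S.addr k ++ [i] := by
      rintro b (⟨hb, hne⟩ | rfl | rfl)
      exacts [.inl ⟨hb, hne⟩, .inr ⟨_, rfl⟩, .inr ⟨_, rfl⟩]
    intro b hb b' hb' hp
    rcases key b hb with ⟨hb, hne⟩ | ⟨i, rfl⟩ <;> rcases key b' hb' with ⟨hb', hne'⟩ | ⟨i', rfl⟩
    · exact ih b hb b' hb' hp
    · rcases List.prefix_concat_iff.1 hp with rfl | hp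
      · exact rfl
      · exact absurd (ih b hb _ ha hp) hne
    · exact absurd (ih _ ha b' hb' ((List.prefix_append _ _).trans hp)).symm hne'
    · exact hp.eq_of_length (by simp)

theorem branch_prefix (i : ℕ → Bool) {m n : ℕ} (hmn : m ≤ n) : branch i m <+: branch i n := by
  obtain ⟨c, rfl⟩ := Nat.exists_eq_add_of_le hmn
  unfold branch
  rw [List.range_add, List.map_append, ← List.cons_append]
  exact List.prefix_append _ _

/-- The addresses of a point are initial segments of one infinite sequence of digits. -/
theorem Schedule.exists_branch (S : Schedule d) (h : ℕ → ℝ) (x : Space d) :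
    ∃ i : ℕ → Bool, ∀ k, ∃ m, S.address h k x = branch i m := by
  classical
  -- Digits that never appear, if the addresses of `x` stay bounded, are set to `0`.
  refine ⟨fun m => decide (∃ k, (S.address h k x)[m + 1]? = some true), fun k =>
    ⟨(S.address h k x).length - 1, ?_⟩⟩
  obtain ⟨t, ht⟩ : [false] <+: S.address h k x := S.address_prefix (k := 0) (Nat.zero_le k)
  have hlen : (S.address h k x).length = t.length + 1 := by rw [← ht]; simp
  refine List.ext_getElem (by simp [branch, hlen]) fun n h1 h2 => ?_
  rcases n with _ | n
  · simp [← ht, branch]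
  · simp only [branch, List.getElem_cons_succ, List.getElem_map, List.getElem_range]
    rw [eq_comm, Bool.eq_iff_iff, decide_eq_true_iff]
    constructor
    · rintro ⟨k', hk'⟩
      obtain ⟨h3, h4⟩ := List.getElem?_eq_some_iff.1 hk'
      rcases le_total k k' with hkk | hkk
      · rw [(S.address_prefix (h := h) (x := x) hkk).getElem h1, h4]
      · rw [← h4, (S.address_prefix (h := h) (x := x) hkk).getElem h3]
    · intro hk
      exact ⟨k, by rw [List.getElem?_eq_getElem h1, hk]⟩

/-- Under an admissible schedule the cell of every point is cut infinitely often in each of the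
directions of the basis. -/
theorem Schedule.infinite_cuts {e : Fin d → Space d}
    (he : ∀ (i : ℕ → Bool) (j : Fin d),
      {k | (∃ m, S.addr k = branch i m) ∧ S.dir k = e j}.Infinite)
    (h : ℕ → ℝ) (x : Space d) (j : Fin d) :
    {k | S.address h k x = S.addr k ∧ S.dir k = e j}.Infinite := by
  obtain ⟨i, hi⟩ := S.exists_branch h x
  refine (he i j).mono ?_
  rintro k ⟨⟨m, hm⟩, hj⟩
  obtain ⟨n, hn⟩ := hi k
  have hx := S.address_mem_leaves h k x
  refine ⟨?_, hj⟩
  rcases le_total m n with hmn | hmn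
  · exact (S.leaves_prefix_free k _ (S.addr_mem k) _ hx
      (by rw [hm, hn]; exact branch_prefix i hmn)).symm
  · exact S.leaves_prefix_free k _ hx _ (S.addr_mem k)
      (by rw [hm, hn]; exact branch_prefix i hmn)

/-! ### Boxes -/

/-- `A` is a box, a product of intervals, in the coordinates `x ↦ ⟪x, e i⟫`: it contains every
point each of whose coordinates lies between the corresponding coordinates of two points
of `A`. -/
def IsBox (e : Fin d → Space d) (A : Set (Space d)) : Prop :=
  ∀ w, (∀ i, ∃ u ∈ A, ∃ v ∈ A, (inner ℝ u (e i) : ℝ) ≤ inner ℝ w (e i) ∧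
    (inner ℝ w (e i) : ℝ) ≤ inner ℝ v (e i)) → w ∈ A

theorem IsBox.inter {e : Fin d → Space d} {A B : Set (Space d)} (hA : IsBox e A)
    (hB : IsBox e B) : IsBox e (A ∩ B) := by
  refine fun w hw => ⟨hA w fun i => ?_, hB w fun i => ?_⟩ <;> obtain ⟨u, hu, v, hv, H⟩ := hw i
  exacts [⟨u, hu.1, v, hv.1, H⟩, ⟨u, hu.2, v, hv.2, H⟩]

theorem isBox_setOf_abs_le (e : Fin d → Space d) (R : ℝ) :
    IsBox e {x | ∀ i, |(inner ℝ x (e i) : ℝ)| ≤ R} := by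
  intro w hw i
  obtain ⟨u, hu, v, hv, h1, h2⟩ := hw i
  exact abs_le.2 ⟨(abs_le.1 (hu i)).1.trans h1, h2.trans (abs_le.1 (hv i)).2⟩

theorem Schedule.isBox_setOf_address_eq {e : Fin d → Space d} (hdir : ∀ k, S.dir k ∈ Set.range e)
    (h : ℕ → ℝ) (k : ℕ) (y : Space d) : IsBox e {x | S.address h k x = S.address h k y} := by
  induction k with
  | zero => exact fun _ _ => rfl
  | succ k ih =>
    intro w hw
    have hwk : S.address h k w = S.address h k y := ih w fun i => by
      obtain ⟨u, hu, v, hv, H⟩ := hw i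
      exact ⟨u, address_eq_of_le k.le_succ hu, v, address_eq_of_le k.le_succ hv, H⟩
    change S.address h (k + 1) w = S.address h (k + 1) y
    by_cases hy : S.address h k y = S.addr k
    · obtain ⟨j, hj⟩ := hdir k
      obtain ⟨u, hu, v, hv, h1, h2⟩ := hw j
      have hu' := (address_eq_of_le k.le_succ hu).trans hy
      have hv' := (address_eq_of_le k.le_succ hv).trans hy
      have hu2 := (address_succ_eq_iff hu' hy).1 hu
      have hv2 := (address_succ_eq_iff hv' hy).1 hv
      rw [address_succ_eq_iff (hwk.trans hy) hy]
      rw [hj] at h1 h2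
      exact ⟨fun H => hv2.1 (H.trans_le h2), fun H => (hu2.2 H).trans_le h1⟩
    · rw [address_succ_of_ne hy, address_succ_of_ne (hwk ▸ hy), hwk]

theorem Schedule.measurableSet_cell (S : Schedule d) (h : ℕ → ℝ) (k : ℕ) (b : List Bool) :
    MeasurableSet (S.cell h k b) := by
  induction k generalizing b with
  | zero => exact MeasurableSet.const ([false] = b)
  | succ k ih => exact S.measurable_next k (h k) (L := S.address h k) ih b

theorem exists_dual_vector (e : Module.Basis (Fin d) ℝ (Space d)) (j : Fin d) :
    ∃ w : Space d, ∀ i, (inner ℝ w (e i) : ℝ) = if i = j then 1 else 0 := by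
  refine ⟨(InnerProductSpace.toDual ℝ (Space d)).symm
    (LinearMap.toContinuousLinearMap (e.coord j)), fun i => ?_⟩
  rw [InnerProductSpace.toDual_symm_apply]
  simp [Finsupp.single_apply]

/-- A slab of width `δ / N` in a box takes at most the `N`-th part of the volume of the box if
the box has width at least `δ` in the direction of the slab. -/
theorem IsBox.volume_slab_le {e : Module.Basis (Fin d) ℝ (Space d)} {A : Set (Space d)}
    (hA : IsBox e A) (hm : MeasurableSet A) {j : Fin d} {u v : Space d} (hu : u ∈ A) (hv : v ∈ A)
    {δ : ℝ} (hδ : 0 < δ) (huv : (inner ℝ u (e j) : ℝ) + δ ≤ inner ℝ v (e j)) {N : ℕ} (hN : 0 < N)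
    (α : ℝ) :
    N * volume (A ∩ {x | α < inner ℝ x (e j) ∧ (inner ℝ x (e j) : ℝ) ≤ α + δ / N}) ≤ volume A := by
  obtain ⟨w, hw⟩ := exists_dual_vector e j
  set E := A ∩ {x | α < inner ℝ x (e j) ∧ (inner ℝ x (e j) : ℝ) ≤ α + δ / N} with hE
  have hz : Measurable fun x : Space d => (inner ℝ x (e j) : ℝ) := by fun_prop
  have hEm : MeasurableSet E :=
    hm.inter ((measurableSet_lt measurable_const hz).inter (measurableSet_le hz measurable_const))
  have hN' : (0 : ℝ) < N := by exact_mod_cast hN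
  -- The `N` translates of the slab along the dual vector `w`, which fill the range of the `j`-th
  -- coordinate between `u` and `u + δ`, are disjoint and stay in the box.
  set F : ℕ → Set (Space d) := fun m =>
    (fun x => x + -((inner ℝ u (e j) + m * (δ / N) - α) • w)) ⁻¹' E with hF
  have hin : ∀ m x i, (inner ℝ (x + -((inner ℝ u (e j) + m * (δ / N) - α) • w)) (e i) : ℝ) =
      inner ℝ x (e i) - (inner ℝ u (e j) + m * (δ / N) - α) * (if i = j then 1 else 0) := by
    intro m x i
    rw [inner_add_left, inner_neg_left, real_inner_smul_left, hw]
    ring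
  have hcoord : ∀ m, ∀ x ∈ F m, inner ℝ u (e j) + m * (δ / N) < inner ℝ x (e j) ∧
      (inner ℝ x (e j) : ℝ) ≤ inner ℝ u (e j) + (m + 1) * (δ / N) := by
    rintro m x ⟨-, h1, h2⟩
    rw [hin, if_pos rfl] at h1 h2
    constructor <;> linarith
  have hsub : ∀ m < N, F m ⊆ A := by
    intro m hmN x hx
    have hc := hcoord m x hx
    have hmN' : (m : ℝ) + 1 ≤ N := by exact_mod_cast hmN
    refine hA x fun i => ?_
    by_cases hij : i = j
    · subst hij
      refine ⟨u, hu, v, hv, ?_, ?_⟩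
      · have : 0 ≤ m * (δ / N) := by positivity
        linarith
      · have : (m + 1) * (δ / N) ≤ N * (δ / N) := by gcongr
        rw [mul_div_cancel₀ _ hN'.ne'] at this
        linarith
    · have := hin m x i
      rw [if_neg hij, mul_zero, sub_zero] at this
      exact ⟨_, hx.1, _, hx.1, this.le, this.ge⟩
  have hdisj : ∀ m n : ℕ, m < n → Disjoint (F m) (F n) := by
    intro m n hmn
    refine Set.disjoint_left.2 fun x hx hx' => ?_
    have h1 := (hcoord m x hx).2
    have h2 := (hcoord n x hx').1
    have hmn' : (m : ℝ) + 1 ≤ n := by exact_mod_cast hmn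
    have : (m + 1) * (δ / N) ≤ n * (δ / N) := by gcongr
    linarith
  calc N * volume E = ∑ m ∈ Finset.range N, volume (F m) := by
        simp [hF, measure_preimage_add_right]
    _ = volume (⋃ m ∈ Finset.range N, F m) := by
        rw [measure_biUnion_finset]
        · intro m _ n _ hmn
          rcases lt_or_gt_of_ne hmn with H | H
          exacts [hdisj m n H, (hdisj n m H).symm]
        · exact fun m _ => hEm.preimage (measurable_add_const _)
    _ ≤ volume A := measure_mono (Set.iUnion₂_subset fun m hm => hsub m (Finset.mem_range.1 hm))

theorem volume_setOf_abs_le_lt_top (e : Module.Basis (Fin d) ℝ (Space d)) (R : ℝ) :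
    volume {x : Space d | ∀ i, |(inner ℝ x (e i) : ℝ)| ≤ R} < ∞ := by
  choose w hw using exists_dual_vector e
  refine Bornology.IsBounded.measure_lt_top (Metric.isBounded_closedBall.subset fun x hx =>
    mem_closedBall_zero_iff.2 (?_ : ‖x‖ ≤ ∑ i, R * ‖w i‖))
  have : x = ∑ i, (inner ℝ x (e i) : ℝ) • w i := by
    refine InnerProductSpace.ext_inner_right_basis e fun i => ?_
    simp [sum_inner, real_inner_smul_left, hw]
  rw [this]
  refine (norm_sum_le _ _).trans (Finset.sum_le_sum fun i _ => ?_)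
  rw [norm_smul]
  exact mul_le_mul_of_nonneg_right (hx i) (norm_nonneg _)

/-! ### Points with the same addresses -/

theorem Schedule.IsMedian.measure_cell {μ : Measure (Space d)} (hμ : S.IsMedian μ h) (k : ℕ)
    [IsFiniteMeasure μ] :
    μ (S.cell h k (S.addr k)) =
        2 * μ (S.cell h k (S.addr k) ∩ {x | inner ℝ x (S.dir k) ≤ h k}) ∧
      μ (S.cell h k (S.addr k)) =
        2 * μ (S.cell h k (S.addr k) ∩ {x | h k < inner ℝ x (S.dir k)}) := by
  have key : ∀ A, ProbabilityTheory.cond μ (S.cell h k (S.addr k)) A = 1 / 2 →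
      μ (S.cell h k (S.addr k)) = 2 * μ (S.cell h k (S.addr k) ∩ A) := by
    intro A hA
    rw [ProbabilityTheory.cond_apply (S.measurableSet_cell h k _)] at hA
    have h0 : μ (S.cell h k (S.addr k)) ≠ 0 := by
      intro h0
      rw [measure_mono_null Set.inter_subset_left h0, mul_zero] at hA
      exact ENNReal.inv_ne_zero.2 ENNReal.ofNat_ne_top ((one_div _).symm.trans hA.symm)
    have : μ (S.cell h k (S.addr k) ∩ A) = μ (S.cell h k (S.addr k)) * (1 / 2) := by
      rw [← hA, ENNReal.mul_inv_cancel_left h0 (measure_ne_top _ _)]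
    rw [this, mul_comm, mul_assoc, one_div, ENNReal.inv_mul_cancel (by simp) (by simp), mul_one]
  exact ⟨key _ (hμ k).1, key _ (hμ k).2⟩

theorem Schedule.IsMedian.abs_height_le {μ : Measure (Space d)} (hμ : S.IsMedian μ h)
    {v : Space d} {R : ℝ} (hv : ∀ᵐ x ∂μ, |(inner ℝ x v : ℝ)| ≤ R) (hk : S.dir k = v) :
    |h k| ≤ R := by
  have key : ∀ A : Set (Space d), ProbabilityTheory.cond μ (S.cell h k (S.addr k)) A = 1 / 2 →
      ∃ x ∈ A, |(inner ℝ x v : ℝ)| ≤ R := by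
    intro A hA
    by_contra! H
    have h0 : μ A = 0 := measure_mono_null (fun x hx => not_le.2 (H x hx)) (ae_iff.1 hv)
    rw [ProbabilityTheory.cond_absolutelyContinuous h0] at hA
    exact ENNReal.inv_ne_zero.2 ENNReal.ofNat_ne_top ((one_div _).symm.trans hA.symm)
  obtain ⟨x, hx, hxR⟩ := key _ (hμ k).1
  obtain ⟨x', hx', hxR'⟩ := key _ (hμ k).2
  have hx : (inner ℝ x (S.dir k) : ℝ) ≤ h k := hx
  have hx' : h k < inner ℝ x' (S.dir k) := hx'
  rw [hk] at hx hx'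
  exact abs_le.2 ⟨(abs_le.1 hxR).1.trans hx, hx'.le.trans (abs_le.1 hxR').2⟩

theorem exists_lt_abs_sub_le {K : Set ℕ} (hK : K.Infinite) {f : ℕ → ℝ} {R η : ℝ}
    (hf : ∀ k ∈ K, |f k| ≤ R) (hη : 0 < η) : ∃ k ∈ K, ∃ n ∈ K, k < n ∧ |f k - f n| ≤ η := by
  obtain ⟨k, hk, n, hn, hkn, H⟩ := hK.exists_lt_map_eq_of_mapsTo (f := fun k => ⌊f k / η⌋)
    (t := Set.Icc ⌊-R / η⌋ ⌊R / η⌋) (fun k hk => by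
      have := abs_le.1 (hf k hk)
      exact ⟨Int.floor_le_floor (by gcongr; exact this.1),
        Int.floor_le_floor (by gcongr; exact this.2)⟩) (Set.finite_Icc _ _)
  refine ⟨k, hk, n, hn, hkn, ?_⟩
  have := Int.abs_sub_lt_one_of_floor_eq_floor H
  rw [← sub_div, abs_div, abs_of_pos hη, div_lt_one hη] at this
  exact this.le

theorem Schedule.lt_inner_iff_of_mem_cell (hy : S.address h k y = S.addr k) {n : ℕ} (hkn : k < n)
    (hyn : S.address h n y = S.addr n) (hx : x ∈ S.cell h n (S.addr n)) :
    h k < inner ℝ x (S.dir k) ↔ h k < inner ℝ y (S.dir k) := by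
  have hxy : S.address h n x = S.address h n y := hx.trans hyn.symm
  exact (address_succ_eq_iff ((address_eq_of_le hkn.le hxy).trans hy) hy).1
    (address_eq_of_le hkn hxy)

/-- If two distinct points share all their addresses, then some of the cells that contain them have
arbitrarily small mass relative to the volume of their bounded parts. Indeed, the heights of the
cuts in a direction `e j` that separates the points accumulate, so some cut discards half of the
mass of the cell in a thin slab, whereas the cell is as wide as the distance of the `j`-th
coordinates of the points. -/
theorem Schedule.IsMedian.exists_sparse_cell {μ : Measure (Space d)} [IsFiniteMeasure μ]
    (hμ : S.IsMedian μ h) {e : Module.Basis (Fin d) ℝ (Space d)}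
    (hdir : ∀ k, S.dir k ∈ Set.range e)
    (he : ∀ (i : ℕ → Bool) (j : Fin d),
      {k | (∃ m, S.addr k = branch i m) ∧ S.dir k = e j}.Infinite)
    {C : ℝ≥0∞} (hC : ∀ A, MeasurableSet A → μ A ≤ C * volume A) {R : ℝ}
    (hR : ∀ᵐ x ∂μ, ∀ i, |(inner ℝ x (e i) : ℝ)| ≤ R) {y y' : Space d}
    (hy : ∀ i, |(inner ℝ y (e i) : ℝ)| ≤ R) (hy' : ∀ i, |(inner ℝ y' (e i) : ℝ)| ≤ R)
    (hyy' : ∀ k, S.address h k y = S.address h k y') {j : Fin d}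
    (hj : (inner ℝ y (e j) : ℝ) < inner ℝ y' (e j)) {N : ℕ} (hN : 0 < N) :
    ∃ k, S.address h k y = S.addr k ∧ N * μ (S.cell h k (S.addr k)) ≤
      2 * C * volume (S.cell h k (S.addr k) ∩ {x | ∀ i, |(inner ℝ x (e i) : ℝ)| ≤ R}) := by
  set δ : ℝ := inner ℝ y' (e j) - inner ℝ y (e j) with hδ
  have hδ0 : 0 < δ := sub_pos.2 hj
  have hNR : (1 : ℝ) ≤ N := by exact_mod_cast hN
  have hδN : δ / N ≤ δ := div_le_self hδ0.le hNR
  obtain ⟨k, ⟨hk, hkj⟩, n, ⟨hn, hnj⟩, hkn, hηkn⟩ :=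
    exists_lt_abs_sub_le (S.infinite_cuts he h y j) (f := h) (R := R) (η := δ / N)
      (fun k hk => hμ.abs_height_le (hR.mono fun x hx => hx j) hk.2) (by positivity)
  refine ⟨n, hn, ?_⟩
  set Q : Set (Space d) := {x | ∀ i, |(inner ℝ x (e i) : ℝ)| ≤ R} with hQ
  set A := S.cell h n (S.addr n) with hA
  have hQm : MeasurableSet Q := by
    rw [hQ, Set.ofPred_forall]
    exact MeasurableSet.iInter fun i => measurableSet_le (by fun_prop) measurable_const
  have hAm : MeasurableSet A := S.measurableSet_cell h n _
  have hbox : IsBox e (A ∩ Q) := by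
    have := S.isBox_setOf_address_eq hdir h n y
    rw [hn] at this
    exact this.inter (isBox_setOf_abs_le e R)
  have hyA : y ∈ A ∩ Q := ⟨hn, hy⟩
  have hyA' : y' ∈ A ∩ Q := ⟨(hyy' n).symm.trans hn, hy'⟩
  have hside : ∀ m, S.address h m y = S.addr m → S.dir m = e j →
      (h m < inner ℝ y (e j) ↔ h m < inner ℝ y' (e j)) := by
    intro m hm hmj
    rw [← hmj]
    exact (S.address_succ_eq_iff hm ((hyy' m).symm.trans hm)).1 (hyy' (m + 1))
  have hsk := hside k hk hkj
  have hsn := hside n hn hnj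
  have hAk : ∀ x ∈ A, (h k < inner ℝ x (e j) ↔ h k < inner ℝ y (e j)) := by
    intro x hx
    rw [← hkj]
    exact lt_inner_iff_of_mem_cell hk hkn hn hx
  have hab := abs_le.1 hηkn
  -- One half of the cell lies in a slab of width `δ / N`.
  obtain ⟨α, D, hD, hDα⟩ : ∃ (α : ℝ) (D : Set (Space d)), μ A = 2 * μ (A ∩ D) ∧
      A ∩ D ⊆ {x | α < inner ℝ x (e j) ∧ (inner ℝ x (e j) : ℝ) ≤ α + δ / N} := by
    by_cases h1 : h k < inner ℝ y (e j) <;> by_cases h2 : h n < inner ℝ y (e j)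
    · refine ⟨h k, _, (hμ.measure_cell n).1, fun x hx => ⟨(hAk x hx.1).2 h1, ?_⟩⟩
      have hx2 : (inner ℝ x (S.dir n) : ℝ) ≤ h n := hx.2
      rw [hnj] at hx2
      linarith
    · rw [hsn] at h2
      linarith
    · rw [hsk] at h1
      linarith
    · refine ⟨h n, _, (hμ.measure_cell n).2, fun x hx => ?_⟩
      have hx2 : h n < inner ℝ x (S.dir n) := hx.2
      have hx3 := not_lt.1 (fun H => h1 ((hAk x hx.1).1 H))
      rw [hnj] at hx2
      exact ⟨hx2, by linarith⟩
  set T := {x : Space d | α < inner ℝ x (e j) ∧ (inner ℝ x (e j) : ℝ) ≤ α + δ / N} with hT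
  have hz : Measurable fun x : Space d => (inner ℝ x (e j) : ℝ) := by fun_prop
  have hTm : MeasurableSet T :=
    (measurableSet_lt measurable_const hz).inter (measurableSet_le hz measurable_const)
  have hAD : μ (A ∩ D) ≤ C * volume (A ∩ Q ∩ T) := by
    refine le_trans (measure_mono_ae ?_) (hC _ ((hAm.inter hQm).inter hTm))
    filter_upwards [hR] with x hx hxD
    exact ⟨⟨hxD.1, hx⟩, hDα hxD⟩
  calc N * μ A = 2 * (N * μ (A ∩ D)) := by rw [hD]; ring
    _ ≤ 2 * (N * (C * volume (A ∩ Q ∩ T))) := by gcongr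
    _ = 2 * C * (N * volume (A ∩ Q ∩ T)) := by ring
    _ ≤ 2 * C * volume (A ∩ Q) := by
      gcongr
      exact hbox.volume_slab_le (hAm.inter hQm) hyA hyA' hδ0 (by linarith) hN α

/-- Vitali covering for the cells, any two of which are nested or disjoint: a set covered by cells
of small density has small measure. -/
theorem Schedule.measure_le_of_cover {μ ν : Measure (Space d)} {c : ℝ≥0∞} (S : Schedule d)
    (h : ℕ → ℝ) {G : Set (Space d)}
    (hG : ∀ y ∈ G, ∃ k, S.address h k y = S.addr k ∧
      c * μ (S.cell h k (S.addr k)) ≤ ν (S.cell h k (S.addr k))) :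
    c * μ G ≤ ν Set.univ := by
  classical
  set A : ℕ → Set (Space d) := fun k => S.cell h k (S.addr k) with hA
  set K : Set ℕ := {k | c * μ (A k) ≤ ν (A k)} with hK
  -- the maximal cells among those of small density
  set M : Set ℕ := {k | k ∈ K ∧ ∀ n < k, n ∈ K → Disjoint (A n) (A k)} with hM
  have hnest : ∀ n k, n < k → ¬ Disjoint (A n) (A k) → A k ⊆ A n := by
    intro n k hnk hd w hw
    obtain ⟨x, hx, hx'⟩ := Set.not_disjoint_iff.1 hd
    have hwx : S.address h k w = S.address h k x := Eq.trans hw hx'.symm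
    exact (address_eq_of_le hnk.le hwx).trans hx
  have hcover : G ⊆ ⋃ k : M, A k := by
    intro y hy
    have hex : ∃ k, y ∈ A k ∧ k ∈ K := hG y hy
    obtain ⟨h1, h2⟩ := Nat.find_spec hex
    refine Set.mem_iUnion.2 ⟨⟨Nat.find hex, h2, fun n hn hnK => ?_⟩, h1⟩
    by_contra hd
    exact Nat.find_min hex hn ⟨hnest n _ hn hd h1, hnK⟩
  have hdisj : Pairwise fun m n : M => Disjoint (A m) (A n) := by
    intro m n hmn
    rcases lt_or_gt_of_ne (Subtype.coe_ne_coe.2 hmn) with H | H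
    exacts [n.2.2 m H m.2.1, (m.2.2 n H n.2.1).symm]
  calc c * μ G ≤ c * ∑' k : M, μ (A k) := by
        gcongr
        exact (measure_mono hcover).trans (measure_iUnion_le _)
    _ = ∑' k : M, c * μ (A k) := ENNReal.tsum_mul_left.symm
    _ ≤ ∑' k : M, ν (A k) := ENNReal.tsum_le_tsum fun k => k.2.1
    _ = ν (⋃ k : M, A k) := (measure_iUnion hdisj fun k => S.measurableSet_cell h k _).symm
    _ ≤ ν Set.univ := measure_mono (Set.subset_univ _)

/-- Almost every point is determined by its addresses among the points of a bounded set of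
full measure. -/
theorem Schedule.IsMedian.ae_eq_of_address_eq {μ : Measure (Space d)} [IsFiniteMeasure μ]
    (hμ : S.IsMedian μ h) (hS : S.Admissible)
    {C : ℝ≥0∞} (hCtop : C ≠ ∞) (hC : ∀ A, MeasurableSet A → μ A ≤ C * volume A)
    {B : Set (Space d)} (hB : IsCompact B) (hμB : ∀ᵐ x ∂μ, x ∈ B) :
    ∀ᵐ y ∂μ, ∀ y' ∈ B, (∀ k, S.address h k y' = S.address h k y) → y' = y := by
  obtain ⟨e, hdir, he⟩ := hS
  obtain ⟨R, hR⟩ := hB.exists_bound_of_continuousOn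
    (f := fun (x : Space d) (i : Fin d) => (inner ℝ x (e i) : ℝ)) (by fun_prop)
  replace hR : ∀ x ∈ B, ∀ i, |(inner ℝ x (e i) : ℝ)| ≤ R := fun x hx i =>
    (norm_le_pi_norm (fun i => (inner ℝ x (e i) : ℝ)) i).trans (hR x hx)
  set Q : Set (Space d) := {x | ∀ i, |(inner ℝ x (e i) : ℝ)| ≤ R} with hQ
  set G : Set (Space d) :=
    {y | y ∈ B ∧ ∃ y' ∈ B, (∀ k, S.address h k y' = S.address h k y) ∧ y' ≠ y} with hG
  have hfin : 2 * C * volume Q ≠ ∞ :=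
    ENNReal.mul_ne_top (ENNReal.mul_ne_top (by simp) hCtop) (volume_setOf_abs_le_lt_top e R).ne
  have hN : ∀ N : ℕ, 0 < N → N * μ G ≤ 2 * C * volume Q := by
    intro N hN
    have := S.measure_le_of_cover (μ := μ) (ν := (2 * C) • volume.restrict Q) (c := N) h (G := G) ?_
    · simpa using this
    rintro y ⟨hy, y', hy', hyy', hne⟩
    have hex : ∃ j, (inner ℝ y (e j) : ℝ) ≠ inner ℝ y' (e j) := by
      by_contra! H
      exact hne (InnerProductSpace.ext_inner_right_basis e H).symm
    obtain ⟨j, hj⟩ := hex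
    have hmeas : ∀ k, ((2 * C) • volume.restrict Q) (S.cell h k (S.addr k)) =
        2 * C * volume (S.cell h k (S.addr k) ∩ Q) := fun k => by
      rw [Measure.smul_apply, Measure.restrict_apply (S.measurableSet_cell h k _), smul_eq_mul]
    simp_rw [hmeas]
    rcases lt_or_gt_of_ne hj with H | H
    · exact hμ.exists_sparse_cell hdir he hC (hμB.mono hR) (hR y hy) (hR y' hy')
        (fun k => (hyy' k).symm) H hN
    · obtain ⟨k, hk, hk'⟩ := hμ.exists_sparse_cell hdir he hC (hμB.mono hR) (hR y' hy') (hR y hy)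
        hyy' H hN
      exact ⟨k, (hyy' k).symm.trans hk, hk'⟩
  have hG0 : μ G = 0 := by
    by_contra h0
    obtain ⟨n, hn⟩ := ENNReal.exists_nat_mul_gt h0 hfin
    rcases Nat.eq_zero_or_pos n with rfl | hpos
    · simp at hn
    · exact (hN n hpos).not_gt hn
  filter_upwards [hμB, measure_eq_zero_iff_ae_notMem.1 hG0] with y hy hyG y' hy' hyy'
  by_contra hne
  exact hyG ⟨hy, y', hy', hyy', hne⟩

/-! ### Dependence on the choice of the heights -/

theorem ae_lt_iff_lt_of_measure_eq {ρ : Measure (Space d)} {f : Space d → ℝ} (hf : Measurable f)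
    {a b : ℝ} (hab : ρ {x | f x ≤ a} = ρ {x | f x ≤ b}) (hfin : ρ {x | f x ≤ a} ≠ ∞) :
    ∀ᵐ x ∂ρ, (a < f x ↔ b < f x) := by
  wlog hle : a ≤ b generalizing a b
  · filter_upwards [this hab.symm (hab ▸ hfin) (le_of_not_ge hle)] with x hx using hx.symm
  have h0 : ρ ({x | f x ≤ b} \ {x | f x ≤ a}) = 0 := by
    have hsub : {x | f x ≤ a} ⊆ {x | f x ≤ b} := fun x hx => le_trans hx hle
    rw [measure_sdiff hsub
      (measurableSet_le hf measurable_const).nullMeasurableSet hfin, hab, tsub_self]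
  filter_upwards [measure_eq_zero_iff_ae_notMem.1 h0] with x hx
  refine ⟨fun H => ?_, fun H => hle.trans_lt H⟩
  by_contra H'
  exact hx ⟨not_lt.1 H', not_le.2 H⟩

/-- The addresses of almost every point do not depend on the choice of the median heights. -/
theorem Schedule.IsMedian.ae_address_eq {μ : Measure (Space d)} [IsFiniteMeasure μ] {h' : ℕ → ℝ}
    (hμ : S.IsMedian μ h) (hμ' : S.IsMedian μ h') (k : ℕ) :
    ∀ᵐ x ∂μ, S.address h k x = S.address h' k x := by
  induction k with
  | zero => exact ae_of_all _ fun _ => rfl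
  | succ k ih =>
    have hcell : S.cell h k (S.addr k) =ᵐ[μ] S.cell h' k (S.addr k) := by
      filter_upwards [ih] with x hx
      exact propext (by
        change S.address h k x = S.addr k ↔ S.address h' k x = S.addr k
        rw [hx])
    have hcond : ProbabilityTheory.cond μ (S.cell h k (S.addr k)) =
        ProbabilityTheory.cond μ (S.cell h' k (S.addr k)) := by
      rw [ProbabilityTheory.cond, ProbabilityTheory.cond, measure_congr hcell,
        Measure.restrict_congr_set hcell]
    have hside := ae_lt_iff_lt_of_measure_eq
      (ρ := ProbabilityTheory.cond μ (S.cell h k (S.addr k)))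
      (f := fun x => inner ℝ x (S.dir k)) (by fun_prop) (a := h k) (b := h' k)
      ((hμ k).1.trans (by rw [hcond]; exact (hμ' k).1.symm)) (by rw [(hμ k).1]; simp)
    rw [ProbabilityTheory.cond,
      Measure.ae_ennreal_smul_measure_iff (ENNReal.inv_ne_zero.2 (measure_ne_top _ _)),
      ae_restrict_iff' (S.measurableSet_cell h k _)] at hside
    filter_upwards [ih, hside] with x hx hx'
    by_cases hk : S.address h k x = S.addr k
    · rw [address_succ_of_eq hk, address_succ_of_eq (hx ▸ hk)]
      simp only [hx' hk]
    · rw [address_succ_of_ne hk, address_succ_of_ne (hx ▸ hk), hx]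

/-! ### Translations -/

instance (μ₀ : Measure (Space d)) [IsProbabilityMeasure μ₀] (θ : Space d) :
    IsProbabilityMeasure (translate μ₀ θ) :=
  Measure.isProbabilityMeasure_map (by fun_prop)

theorem translate_absolutelyContinuous {μ₀ : Measure (Space d)} (hμ₀ : μ₀ ≪ volume)
    (θ : Space d) : translate μ₀ θ ≪ volume := by
  have := hμ₀.map (measurable_add_const θ)
  rwa [map_add_right_eq_self volume] at this

theorem translate_apply (μ₀ : Measure (Space d)) (θ : Space d) (A : Set (Space d)) :
    translate μ₀ θ A = μ₀ ((fun x => x + θ) ⁻¹' A) :=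
  (MeasurableEquiv.addRight θ).map_apply A

theorem ae_translate_iff {μ₀ : Measure (Space d)} {θ : Space d} {P : Space d → Prop} :
    (∀ᵐ x ∂translate μ₀ θ, P x) ↔ ∀ᵐ x ∂μ₀, P (x + θ) := by
  rw [ae_iff, ae_iff, translate_apply]
  rfl

theorem mem_support_translate {μ₀ : Measure (Space d)} {θ x : Space d} :
    x + θ ∈ (translate μ₀ θ).support ↔ x ∈ μ₀.support := by
  simp only [Measure.mem_support_iff_forall, translate_apply]
  constructor
  · intro H U hU
    have hU' : (fun y => y + -θ) ⁻¹' U ∈ 𝓝 (x + θ) :=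
      (continuous_add_const (-θ)).continuousAt.preimage_mem_nhds (by simpa using hU)
    simpa [Set.preimage_preimage] using H _ hU'
  · intro H U hU
    exact H _ ((continuous_add_const θ).continuousAt.preimage_mem_nhds hU)

theorem mem_interior_support_translate {μ₀ : Measure (Space d)} {θ x : Space d} :
    x + θ ∈ interior (translate μ₀ θ).support ↔ x ∈ interior μ₀.support := by
  have : (Homeomorph.addRight θ) ⁻¹' (translate μ₀ θ).support = μ₀.support :=
    Set.ext fun x => mem_support_translate
  rw [← this, ← Homeomorph.preimage_interior]
  rfl

/-- The heights `h` of cuts of a translate by `θ`, transferred to the original measure. -/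
noncomputable def Schedule.shift (S : Schedule d) (θ : Space d) (h : ℕ → ℝ) (k : ℕ) : ℝ :=
  h k - inner ℝ θ (S.dir k)

theorem Schedule.address_add (S : Schedule d) (θ : Space d) (h : ℕ → ℝ) (k : ℕ) (x : Space d) :
    S.address h k (x + θ) = S.address (S.shift θ h) k x := by
  induction k with
  | zero => rfl
  | succ k ih =>
    rw [Schedule.address, Schedule.address, ih, inner_add_left, shift]
    simp only [sub_lt_iff_lt_add]

theorem Schedule.level_add (S : Schedule d) (θ : Space d) (h : ℕ → ℝ) (x : Space d) :
    S.level h (x + θ) = S.level (S.shift θ h) x := by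
  simp only [level, levelAt, address_add]

theorem Schedule.IsMedian.shift {μ₀ : Measure (Space d)} {θ : Space d}
    (hμ : S.IsMedian (translate μ₀ θ) h) : S.IsMedian μ₀ (S.shift θ h) := by
  intro k
  have := hμ k
  rw [ProbabilityTheory.cond_apply (S.measurableSet_cell h k _),
    ProbabilityTheory.cond_apply (S.measurableSet_cell h k _)] at this
  rw [ProbabilityTheory.cond_apply (S.measurableSet_cell _ k _),
    ProbabilityTheory.cond_apply (S.measurableSet_cell _ k _)]
  simpa only [translate_apply, Set.preimage_inter, cell, Set.preimage_ofPred_eq, address_add,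
    inner_add_left, Schedule.shift, sub_lt_iff_lt_add, le_sub_iff_add_le] using this

/-! ### The no-collision map between translates -/

theorem ClassK.absolutelyContinuous {μ : Measure (Space d)} (hμ : ClassK μ) : μ ≪ volume := by
  obtain ⟨f, c, C, hf, -, hμf, -⟩ := hμ.density
  rw [hμf]
  exact withDensity_absolutelyContinuous _ _

theorem ClassK.exists_le_volume {μ : Measure (Space d)} (hμ : ClassK μ) :
    ∃ C : ℝ≥0∞, C ≠ ∞ ∧ ∀ A, MeasurableSet A → μ A ≤ C * volume A := by
  obtain ⟨f, c, C, hf, -, hμf, -, -, hC⟩ := hμ.density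
  refine ⟨ENNReal.ofReal C, ENNReal.ofReal_ne_top, fun A hA => ?_⟩
  have hm : MeasurableSet {x | f x ≤ C} := measurableSet_le hf measurable_const
  calc μ A ≤ μ (A ∩ {x | f x ≤ C}) := measure_mono_ae (hC.mono fun x hx hxA => ⟨hxA, hx.2⟩)
    _ = ∫⁻ x in A ∩ {x | f x ≤ C}, ENNReal.ofReal (f x) := by
      conv_lhs => rw [hμf]
      exact withDensity_apply _ (hA.inter hm)
    _ ≤ ∫⁻ x in A ∩ {x | f x ≤ C}, ENNReal.ofReal C :=
      setLIntegral_mono measurable_const fun x hx => ENNReal.ofReal_le_ofReal hx.2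
    _ ≤ ENNReal.ofReal C * volume A := by
      rw [setLIntegral_const]
      gcongr
      exact Set.inter_subset_left

theorem ClassK.ae_mem_interior_support {μ : Measure (Space d)} (hμ : ClassK μ) :
    ∀ᵐ x ∂μ, x ∈ interior μ.support := by
  filter_upwards [Measure.support_mem_ae (μ := μ),
    measure_eq_zero_iff_ae_notMem.1 hμ.frontier_support] with x hx hx'
  by_contra H
  exact hx' ⟨subset_closure hx, H⟩

theorem Slicing.ae_matches_translate_iff {μ₀ : Measure (Space d)} (hμ₀ : ClassK μ₀)
    (hS : S.Admissible) (H : Slicing S) (θ θ' : Space d) :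
    ∀ᵐ x ∂μ₀, ∀ y, H.Matches (translate μ₀ θ) (translate μ₀ θ') (x + θ) y ↔ y = x + θ' := by
  have := hμ₀.isProbabilityMeasure
  have hmed : ∀ θ, S.IsMedian μ₀ (S.shift θ (H.height (translate μ₀ θ))) := fun θ =>
    (H.isMedian _ inferInstance (translate_absolutelyContinuous hμ₀.absolutelyContinuous θ)).shift
  obtain ⟨C, hCtop, hC⟩ := hμ₀.exists_le_volume
  filter_upwards [hμ₀.ae_mem_interior_support,
    ae_all_iff.2 ((hmed θ).ae_address_eq (hmed θ')),
    (hmed θ').ae_eq_of_address_eq hS hCtop hC hμ₀.isCompact_support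
      Measure.support_mem_ae] with x hx hadd hinj y
  have hlevel : S.level (S.shift θ (H.height (translate μ₀ θ))) x =
      S.level (S.shift θ' (H.height (translate μ₀ θ'))) x := by
    simp only [Schedule.level, Schedule.levelAt, hadd]
  obtain ⟨y, rfl⟩ : ∃ z, z + θ' = y := ⟨y - θ', sub_add_cancel _ _⟩
  rw [Slicing.Matches, mem_interior_support_translate, S.level_add, S.level_add, hlevel,
    add_left_inj]
  refine ⟨fun ⟨h1, h2⟩ => ?_, ?_⟩
  · exact hinj y (interior_subset h1) fun k => Schedule.address_eq_of_level_eq h2 k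
  · rintro rfl
    exact ⟨hx, rfl⟩

theorem Slicing.map_eq_of_matches {μ ν : Measure (Space d)} {H : Slicing S}
    (hxy : ∀ z, H.Matches μ ν x z ↔ z = y) : H.map μ ν x = y := by
  have hex : ∃! z, H.Matches μ ν x z := ⟨y, (hxy y).2 rfl, fun z hz => (hxy z).1 hz⟩
  rw [Slicing.map, dif_pos hex]
  exact (hxy _).1 hex.choose_spec.1

theorem Slicing.map_translate_ae_eq {μ₀ : Measure (Space d)} (hμ₀ : ClassK μ₀)
    (hS : S.Admissible) (H : Slicing S) (θ θ' : Space d) :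
    H.map (translate μ₀ θ) (translate μ₀ θ') =ᵐ[translate μ₀ θ] fun x => x + (θ' - θ) := by
  refine ae_translate_iff.2 ?_
  filter_upwards [H.ae_matches_translate_iff hμ₀ hS θ θ'] with x hx
  rw [map_eq_of_matches hx]
  abel

theorem translate_map_add (μ₀ : Measure (Space d)) (θ θ' : Space d) :
    (translate μ₀ θ).map (fun x => x + (θ' - θ)) = translate μ₀ θ' := by
  rw [translate, Measure.map_map (by fun_prop) (by fun_prop), translate]
  congr 1
  ext1 x
  simp

theorem Slicing.mapWellDefined_translate {μ₀ : Measure (Space d)} (hμ₀ : ClassK μ₀)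
    (hS : S.Admissible) (H : Slicing S) (θ θ' : Space d) :
    H.MapWellDefined (translate μ₀ θ) (translate μ₀ θ') := by
  have hmap := H.map_translate_ae_eq hμ₀ hS θ θ'
  refine ⟨ae_translate_iff.2 ?_, AEMeasurable.congr (by fun_prop) hmap.symm, ?_⟩
  · filter_upwards [H.ae_matches_translate_iff hμ₀ hS θ θ', hμ₀.ae_mem_interior_support]
      with x hx hx'
    exact ⟨mem_interior_support_translate.2 hx', x + θ', (hx _).2 rfl, fun z hz => (hx z).1 hz⟩
  · rw [Measure.map_congr hmap, translate_map_add]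

/-! ### Optimal transport between translates -/

theorem cost_add_const (p : ℝ) (μ : Measure (Space d)) [IsProbabilityMeasure μ] (v : Space d) :
    cost p μ (fun x => x + v) = ‖v‖ₑ ^ p := by
  simp [cost]

/-- By Jensen's inequality a transport map costs at least as much as the translation by the
difference of the barycenters. -/
theorem le_cost_translate {p : ℝ} (hp : 1 ≤ p) {μ₀ : Measure (Space d)} [IsProbabilityMeasure μ₀]
    (hint : Integrable (fun x => x) μ₀) (θ θ' : Space d) {T : Space d → Space d}
    (hT : Measurable T) (hTμ : (translate μ₀ θ).map T = translate μ₀ θ') :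
    ‖θ' - θ‖ₑ ^ p ≤ cost p (translate μ₀ θ) T := by
  have hintθ : ∀ θ, Integrable (fun x => x) (translate μ₀ θ) := fun θ =>
    (integrable_map_measure (by fun_prop) (by fun_prop)).2 (hint.add (integrable_const θ))
  have hmean : ∀ θ, ∫ x, x ∂translate μ₀ θ = ∫ x, x ∂μ₀ + θ := fun θ => by
    rw [translate, integral_map (by fun_prop) (by fun_prop),
      integral_add hint (integrable_const θ)]
    simp
  have hTint : Integrable T (translate μ₀ θ) := by
    have := hintθ θ'
    rw [← hTμ] at this
    exact (integrable_map_measure (g := fun x => x) (by fun_prop) (by fun_prop)).1 this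
  have hTmean : ∫ x, T x ∂translate μ₀ θ = ∫ x, x ∂μ₀ + θ' := by
    rw [← hmean θ', ← hTμ, integral_map (by fun_prop) (by fun_prop)]
  have hdiff : ∫ x, (T x - x) ∂translate μ₀ θ = θ' - θ := by
    rw [integral_sub hTint (hintθ θ), hTmean, hmean]
    abel
  have hp0 : 0 < p := by linarith
  have h1 : ‖θ' - θ‖ₑ ≤ eLpNorm' (fun x => T x - x) 1 (translate μ₀ θ) := by
    rw [← hdiff, eLpNorm'_eq_lintegral_enorm]
    simpa using enorm_integral_le_lintegral_enorm fun x => T x - x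
  have h2 : eLpNorm' (fun x => T x - x) 1 (translate μ₀ θ) ≤
      eLpNorm' (fun x => T x - x) p (translate μ₀ θ) :=
    eLpNorm'_le_eLpNorm'_of_exponent_le one_pos hp _ (by fun_prop)
  calc ‖θ' - θ‖ₑ ^ p ≤ (eLpNorm' (fun x => T x - x) p (translate μ₀ θ)) ^ p :=
        ENNReal.rpow_le_rpow (h1.trans h2) hp0.le
    _ = cost p (translate μ₀ θ) T := by
      rw [eLpNorm'_eq_lintegral_enorm, ← ENNReal.rpow_mul, one_div_mul_cancel hp0.ne',
        ENNReal.rpow_one, cost]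

theorem isLeast_transportCosts_translate {p : ℝ} (hp : 1 ≤ p) {μ₀ : Measure (Space d)}
    [IsProbabilityMeasure μ₀] (hint : Integrable (fun x => x) μ₀) (θ θ' : Space d) :
    IsLeast (transportCosts p (translate μ₀ θ) (translate μ₀ θ')) (‖θ' - θ‖ₑ ^ p) := by
  constructor
  · exact ⟨fun x => x + (θ' - θ), by fun_prop, translate_map_add μ₀ θ θ',
      (cost_add_const p _ _).symm⟩
  · rintro _ ⟨T, hT, hTμ, rfl⟩
    exact le_cost_translate hp hint θ θ' hT hTμ

theorem ClassK.integrable_id {μ : Measure (Space d)} (hμ : ClassK μ) :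
    Integrable (fun x => x) μ := by
  have := hμ.isProbabilityMeasure
  obtain ⟨R, hR⟩ := hμ.isCompact_support.isBounded.exists_norm_le
  exact Integrable.of_bound (by fun_prop) R (mem_of_superset Measure.support_mem_ae hR)

theorem wasserstein_translate {p : ℝ} (hp : 1 ≤ p) {μ₀ : Measure (Space d)}
    [IsProbabilityMeasure μ₀] (hint : Integrable (fun x => x) μ₀) (θ θ' : Space d) :
    wasserstein p (translate μ₀ θ) (translate μ₀ θ') = ENNReal.ofReal ‖θ - θ'‖ := by
  rw [wasserstein, (isLeast_transportCosts_translate hp hint θ θ').csInf_eq, ← ENNReal.rpow_mul,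
    mul_one_div_cancel (by linarith), ENNReal.rpow_one, ofReal_norm, ← enorm_neg, neg_sub]

theorem Slicing.dist_translate {p : ℝ} (hp : 1 ≤ p) {μ₀ : Measure (Space d)} (hμ₀ : ClassK μ₀)
    (hS : S.Admissible) (H : Slicing S) (θ θ' : Space d) :
    H.dist p (translate μ₀ θ) (translate μ₀ θ') = ENNReal.ofReal ‖θ - θ'‖ := by
  have := hμ₀.isProbabilityMeasure
  have hcost : cost p (translate μ₀ θ) (H.map (translate μ₀ θ) (translate μ₀ θ')) =
      cost p (translate μ₀ θ) fun x => x + (θ' - θ) :=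
    lintegral_congr_ae ((H.map_translate_ae_eq hμ₀ hS θ θ').mono fun x hx => by simp only [hx])
  rw [Slicing.dist, hcost, cost_add_const, ← ENNReal.rpow_mul,
    mul_one_div_cancel (by linarith), ENNReal.rpow_one, ofReal_norm, ← enorm_neg, neg_sub]

theorem translate_injective {μ₀ : Measure (Space d)} [IsProbabilityMeasure μ₀]
    (hint : Integrable (fun x => x) μ₀) : Function.Injective (translate μ₀) := by
  intro θ θ' heq
  have h1 := wasserstein_translate le_rfl hint θ θ'
  rw [← heq, wasserstein_translate le_rfl hint θ θ, sub_self, norm_zero, ENNReal.ofReal_zero,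
    eq_comm, ENNReal.ofReal_eq_zero] at h1
  exact sub_eq_zero.1 (norm_le_zero_iff.1 h1)

end NoCollision

theorem mainTheorem1 {d : ℕ} (μ₀ : MeasureTheory.Measure (NoCollision.Space d))
    (hμ₀ : NoCollision.ClassK μ₀) (S : NoCollision.Schedule d) (hS : S.Admissible)
    (H : NoCollision.Slicing S) (p : ℝ) (hp : 1 ≤ p) :
    (∀ θ θ' : NoCollision.Space d,
      H.MapWellDefined (NoCollision.translate μ₀ θ) (NoCollision.translate μ₀ θ') ∧
      H.dist p (NoCollision.translate μ₀ θ) (NoCollision.translate μ₀ θ') =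
        NoCollision.wasserstein p (NoCollision.translate μ₀ θ) (NoCollision.translate μ₀ θ') ∧
      NoCollision.wasserstein p (NoCollision.translate μ₀ θ) (NoCollision.translate μ₀ θ') =
        ENNReal.ofReal ‖θ - θ'‖ ∧
      sInf (NoCollision.transportCosts p (NoCollision.translate μ₀ θ)
          (NoCollision.translate μ₀ θ')) ∈
        NoCollision.transportCosts p (NoCollision.translate μ₀ θ)
          (NoCollision.translate μ₀ θ')) ∧
    ∀ Θ : Set (NoCollision.Space d),
      ∃ m : MetricSpace (NoCollision.translate μ₀ '' Θ),
        (∀ μ ν : NoCollision.translate μ₀ '' Θ, edist μ ν = H.dist p μ ν) ∧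
        ∃ Φ : Θ ≃ᵢ NoCollision.translate μ₀ '' Θ,
          ∀ θ : Θ, (Φ θ : MeasureTheory.Measure (NoCollision.Space d)) =
            NoCollision.translate μ₀ θ := by
  have := hμ₀.isProbabilityMeasure
  have hint := hμ₀.integrable_id
  refine ⟨fun θ θ' => ⟨H.mapWellDefined_translate hμ₀ hS θ θ', ?_,
    NoCollision.wasserstein_translate hp hint θ θ', ?_⟩, fun Θ => ?_⟩
  · rw [H.dist_translate hp hμ₀ hS, NoCollision.wasserstein_translate hp hint]
  · have hleast := NoCollision.isLeast_transportCosts_translate hp hint θ θ'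
    rw [hleast.csInf_eq]
    exact hleast.1
  · set Φ := Equiv.Set.image (NoCollision.translate μ₀) Θ (NoCollision.translate_injective hint)
    let _ : MetricSpace (NoCollision.translate μ₀ '' Θ) :=
      MetricSpace.induced Φ.symm Φ.symm.injective inferInstance
    have hedist : ∀ θ θ' : Θ, edist (Φ θ) (Φ θ') = edist θ θ' := fun θ θ' => by
      change edist (Φ.symm (Φ θ)) (Φ.symm (Φ θ')) = edist θ θ'
      rw [Φ.symm_apply_apply, Φ.symm_apply_apply]
    refine ⟨‹_›, fun μ ν => ?_, ⟨Φ, fun θ θ' => hedist θ θ'⟩, fun θ => rfl⟩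
    obtain ⟨θ, rfl⟩ := Φ.surjective μ
    obtain ⟨θ', rfl⟩ := Φ.surjective ν
    rw [hedist]
    exact (by rw [Subtype.edist_eq, edist_dist, dist_eq_norm]
      : edist θ θ' = ENNReal.ofReal ‖(θ : NoCollision.Space d) - θ'‖).trans
        (H.dist_translate hp hμ₀ hS θ θ').symm
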